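/- Let $d_x,d_y,d_z\ge 1$, $\mathcal X=\mathbb R^{d_x}$, $\mathcal Y=\mathbb R^{d_y}$, $\mathcal Z=\mathbb R^{d_z}$, $\ddot{\mathcal X}=\mathcal X\times\mathcal Z$, and let $(X,Z,Y)$ be a random vector in $\mathcal X\times\mathcal Z\times\mathcal Y$ with law $P_{XZY}$; write $\ddot X=(X,Z)$. Let $k=k_{\ddot{\mathcal X}}\otimes k_{\mathcal Y}$, i.e. $k((\ddot x,y),(\ddot x',y'))=k_{\ddot{\mathcal X}}(\ddot x,\ddot x')\,k_{\mathcal Y}(y,y')$, be the tensor product of two positive definite real kernels $k_{\ddot{\mathcal X}}$ on $\ddot{\mathcal X}$ and $k_{\mathcal Y}$ on $\mathcal Y$. (A kernel is positive definite if it is symmetric and $\sum_{i,j}c_ic_jk(s_i,s_j)\ge 0$ for all finite families.) Assume that $k$ is positive definite; characteristic (the map $\nu\mapsto\int k(s,\cdot)\,d\nu(s)$ is injective on Borel probability measures on $\ddot{\mathcal X}\times\mathcal Y$); bounded; continuous; and real analytic as a function on $(\ddot{\mathcal X}\times\mathcal Y)\times(\ddot{\mathcal X}\times\mathcal Y)$.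 Let $(x_i,z_i,y_i)_{i\ge1}$ be i.i.d. with law $P_{XZY}$, and put $\ddot x_i=(x_i,z_i)$. Let $p\ge1$ be real, $J\ge1$ an integer, and for locations $(\mathbf t^{(1)}_j,t^{(2)}_j)\in\ddot{\mathcal X}\times\mathcal Y$, $1\le j\le J$, put $$u_i(j)=\bigl(k_{\ddot{\mathcal X}}(\mathbf t^{(1)}_j,\ddot x_i)-\mathbb E[k_{\ddot{\mathcal X}}(\mathbf t^{(1)}_j,\ddot X)\mid Z=z_i]\bigr)\bigl(k_{\mathcal Y}(t^{(2)}_j,y_i)-\mathbb E[k_{\mathcal Y}(t^{(2)}_j,Y)\mid Z=z_i]\bigr),$$ where the conditional means are taken under $P_{XZY}$ through regular conditional distributions given $Z$. Let $\mathbf u_i=(u_i(1),\dots,u_i(J))^T$, $$\mathbf S_n=\frac1n\sum_{i=1}^n\mathbf u_i,\qquad \mathrm{CI}_{n,p}=\sum_{j=1}^J|\mathbf S_n(j)|^p,\qquad \boldsymbol\Sigma=\mathbb E[\mathbf u_1\mathbf u_1^T].$$ (i) If $X\perp Y\mid Z$ ($H_0$), then for every choice of the locations $(\mathbf t^{(1)}_j,t^{(2)}_j)_{j=1}^J$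 the entries of $\mathbf u_1\mathbf u_1^T$ are integrable, $\boldsymbol\Sigma$ is positive semidefinite, and $\sqrt n\,\mathbf S_n\to\mathcal N(0,\boldsymbol\Sigma)$ in distribution as $n\to\infty$. (ii) If $X\not\perp Y\mid Z$ ($H_1$), then for every Borel probability measure $\Gamma$ on $\ddot{\mathcal X}\times\mathcal Y$ that is absolutely continuous with respect to Lebesgue measure, for $\Gamma^{\otimes J}$-almost every choice of the locations $(\mathbf t^{(1)}_j,t^{(2)}_j)_{j=1}^J$ and for every $q\in\mathbb R$, $$\lim_{n\to\infty}\mathbb P\bigl(n^{p/2}\,\mathrm{CI}_{n,p}\ge q\bigr)=1,$$ the probability being over the sample, with the locations held fixed. -/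

import Mathlib

open MeasureTheory ProbabilityTheory Filter Topology

noncomputable section

/-- `ℝ^d` with its Euclidean structure. -/
abbrev Euc (d : ℕ) : Type := EuclideanSpace ℝ (Fin d)

/-- The space of the extended variable `(X, Z)`. -/
abbrev XZSpace (dx dz : ℕ) : Type := Euc dx × Euc dz

/-- The space of locations, and the domain of the kernel `k`: pairs `((x, z), y)`. -/
abbrev LocSpace (dx dy dz : ℕ) : Type := XZSpace dx dz × Euc dy

/-- The space in which the random vector `(X, Z, Y)` takes its values. -/
abbrev ObsSpace (dx dy dz : ℕ) : Type := Euc dx × Euc dz × Euc dy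

section Kernels

/-- The tensor-product kernel `((a, b), (a', b')) ↦ k₁ (a, a') * k₂ (b, b')`. -/
def tensorKernel {A B : Type*} (k₁ : A → A → ℝ) (k₂ : B → B → ℝ) : A × B → A × B → ℝ :=
  fun s t => k₁ s.1 t.1 * k₂ s.2 t.2

/-- A positive definite kernel in the sense of reproducing kernels: `k` is symmetric and
`∑ i, ∑ j, c i * c j * k (x i) (x j) ≥ 0` for all finite families. -/
def IsPosDefKernel {D : Type*} (k : D → D → ℝ) : Prop :=
  (Matrix.of k).PosSemidef

/-- The mean embedding `t ↦ ∫ k (x, t) dν(x)` of a measure. -/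
def meanEmbedding {D : Type*} [MeasurableSpace D] (k : D → D → ℝ) (ν : Measure D) : D → ℝ :=
  fun t => ∫ x, k x t ∂ν

/-- A kernel is characteristic if the mean embedding is injective on probability measures. -/
def IsCharacteristicKernel {D : Type*} [MeasurableSpace D] (k : D → D → ℝ) : Prop :=
  ∀ ν₁ ν₂ : Measure D, IsProbabilityMeasure ν₁ → IsProbabilityMeasure ν₂ →
    meanEmbedding k ν₁ = meanEmbedding k ν₂ → ν₁ = ν₂

/-- The assumption on the kernel: `k` is the tensor product of the kernels `kX` and `kY`, and is
positive definite, characteristic, bounded, continuous and real analytic (as a function of its two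
arguments). -/
structure KernelAssumption {dx dy dz : ℕ} (k : LocSpace dx dy dz → LocSpace dx dy dz → ℝ)
    (kX : XZSpace dx dz → XZSpace dx dz → ℝ) (kY : Euc dy → Euc dy → ℝ) : Prop where
  posDef_left : IsPosDefKernel kX
  posDef_right : IsPosDefKernel kY
  tensor : k = tensorKernel kX kY
  posDef : IsPosDefKernel k
  characteristic : IsCharacteristicKernel k
  bounded : ∃ C : ℝ, ∀ s t, |k s t| ≤ C
  continuous : Continuous fun q : LocSpace dx dy dz × LocSpace dx dy dz => k q.1 q.2
  analytic : AnalyticOnNhd ℝ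
    (fun q : LocSpace dx dy dz × LocSpace dx dy dz => k q.1 q.2) Set.univ

end Kernels

section Model

variable {dx dy dz : ℕ}

/-- The coordinate variable `X`. -/
def varX (w : ObsSpace dx dy dz) : Euc dx := w.1

/-- The coordinate variable `Z`. -/
def varZ (w : ObsSpace dx dy dz) : Euc dz := w.2.1

/-- The coordinate variable `Y`. -/
def varY (w : ObsSpace dx dy dz) : Euc dy := w.2.2

/-- The extended variable `(X, Z)`. -/
def varXZ (w : ObsSpace dx dy dz) : XZSpace dx dz := (w.1, w.2.1)

theorem measurable_varZ : Measurable (varZ : ObsSpace dx dy dz → Euc dz) :=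
  measurable_fst.comp measurable_snd

/-- The null hypothesis: under the law `P` of `(X, Z, Y)`, the variables `X` and `Y` are
conditionally independent given `Z`. -/
def NullHypothesis (P : Measure (ObsSpace dx dy dz)) [IsProbabilityMeasure P] : Prop :=
  CondIndepFun (MeasurableSpace.comap varZ inferInstance) measurable_varZ.comap_le varX varY P

/-- The conditional mean `z ↦ 𝔼[kX (t, (X, Z)) | Z = z]`, through the regular conditional
distribution of `(X, Z)` given `Z`. -/
def condMeanXZ (P : Measure (ObsSpace dx dy dz)) [IsProbabilityMeasure P]
    (kX : XZSpace dx dz → XZSpace dx dz → ℝ) (t : XZSpace dx dz) (z : Euc dz) : ℝ :=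
  ∫ a, kX t a ∂(condDistrib varXZ varZ P z)

/-- The conditional mean `z ↦ 𝔼[kY (t, Y) | Z = z]`, through the regular conditional
distribution of `Y` given `Z`. -/
def condMeanY (P : Measure (ObsSpace dx dy dz)) [IsProbabilityMeasure P]
    (kY : Euc dy → Euc dy → ℝ) (t : Euc dy) (z : Euc dz) : ℝ :=
  ∫ y, kY t y ∂(condDistrib varY varZ P z)

/-- The product of the two centred kernel evaluations at the location `t = (t⁽¹⁾, t⁽²⁾)` and the
observation `w = (x, z, y)`. -/
def oracleTerm (P : Measure (ObsSpace dx dy dz)) [IsProbabilityMeasure P]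
    (kX : XZSpace dx dz → XZSpace dx dz → ℝ) (kY : Euc dy → Euc dy → ℝ)
    (t : LocSpace dx dy dz) (w : ObsSpace dx dy dz) : ℝ :=
  (kX t.1 (varXZ w) - condMeanXZ P kX t.1 (varZ w)) *
    (kY t.2 (varY w) - condMeanY P kY t.2 (varZ w))

/-- The estimate `Δ_n(t) = (1 / n) ∑_{i < n} oracleTerm t (w i)` from the first `n`
observations. -/
def oracleDelta (P : Measure (ObsSpace dx dy dz)) [IsProbabilityMeasure P]
    (kX : XZSpace dx dz → XZSpace dx dz → ℝ) (kY : Euc dy → Euc dy → ℝ)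
    (w : ℕ → ObsSpace dx dy dz) (n : ℕ) (t : LocSpace dx dy dz) : ℝ :=
  (1 / (n : ℝ)) * ∑ i ∈ Finset.range n, oracleTerm P kX kY t (w i)

/-- The vector `S_n = (Δ_n(t_1), …, Δ_n(t_J))`. -/
def oracleS (P : Measure (ObsSpace dx dy dz)) [IsProbabilityMeasure P]
    (kX : XZSpace dx dz → XZSpace dx dz → ℝ) (kY : Euc dy → Euc dy → ℝ) {J : ℕ}
    (t : Fin J → LocSpace dx dy dz) (w : ℕ → ObsSpace dx dy dz) (n : ℕ) :
    EuclideanSpace ℝ (Fin J) :=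
  WithLp.toLp 2 fun j => oracleDelta P kX kY w n (t j)

/-- The statistic `CI_{n,p} = ∑_j |Δ_n(t_j)| ^ p`. -/
def oracleCI (P : Measure (ObsSpace dx dy dz)) [IsProbabilityMeasure P]
    (kX : XZSpace dx dz → XZSpace dx dz → ℝ) (kY : Euc dy → Euc dy → ℝ) {J : ℕ}
    (t : Fin J → LocSpace dx dy dz) (p : ℝ) (w : ℕ → ObsSpace dx dy dz) (n : ℕ) : ℝ :=
  ∑ j, |oracleDelta P kX kY w n (t j)| ^ p

/-- The matrix `Σ = 𝔼[u uᵀ]`, where `u = (oracleTerm t_1, …, oracleTerm t_J)` and the observation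
has law `P`. -/
def oracleCov (P : Measure (ObsSpace dx dy dz)) [IsProbabilityMeasure P]
    (kX : XZSpace dx dz → XZSpace dx dz → ℝ) (kY : Euc dy → Euc dy → ℝ) {J : ℕ}
    (t : Fin J → LocSpace dx dy dz) : Matrix (Fin J) (Fin J) ℝ :=
  Matrix.of fun j l => ∫ w, oracleTerm P kX kY (t j) w * oracleTerm P kX kY (t l) w ∂P

end Model

end

/-! The mean of `oracleTerm` at t is T(t), the mean embedding of the law of ((X, Z), Y) minus that
of `condIndepLaw` (`KernelAssumption.integral_oracleTerm`), and the two laws agree exactly under H₀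
(`nullHypothesis_iff`). Under H₀ the summands are therefore bounded, centred and i.i.d., and the
central limit theorem applies. Under H₁, T is not identically zero since k is characteristic. Once T
≠ 0 almost everywhere, the law of large numbers gives |Δ_n(t_j)|^p a positive limit, and the factor
n^(p/2) drives the statistic to infinity.

The hard point is T ≠ 0 almost everywhere. Analyticity of k alone does not pass to the embedding,
because the radius of convergence of k(x, ·) may shrink as x varies. Positive definiteness repairs
this: Cauchy-Schwarz, applied to finite differences, bounds the n-th Taylor coefficient of s ↦ k(x,
γ(s)) by k(x, x) and the order 2n Taylor term of k(γ(s), γ(t)), which does not involve x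
(`IsPosDefKernel.coeff_sq_le`). Hence embeddings are analytic along lines
(`IsPosDefKernel.analyticAt_integral`), and Fubini over the lines through one point where T ≠ 0
finishes (`ae_ne_zero_of_analytic_on_lines`); joint analyticity of T is never needed. -/

noncomputable section

/-! ### Finite differences and Taylor coefficients -/

section Differences

/-- A weighted sum of dilates of an analytic function whose weights annihilate the Taylor terms of
order less than `m` is governed by the Taylor term of order `m`. -/
theorem HasFPowerSeriesAt.tendsto_weighted_sum {E : Type*} [NormedAddCommGroup E]
    [NormedSpace ℝ E] {F : E → ℝ} {q : FormalMultilinearSeries ℝ E ℝ}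
    (hF : HasFPowerSeriesAt F q 0) {ι : Type*} (S : Finset ι) (c : ι → ℝ) (v : ι → E) (m : ℕ)
    (h0 : ∀ k < m, ∑ a ∈ S, c a * q k (fun _ => v a) = 0) :
    Tendsto (fun h : ℝ => (h ^ m)⁻¹ * ∑ a ∈ S, c a * F (h • v a)) (𝓝[≠] 0)
      (𝓝 (∑ a ∈ S, c a * q m (fun _ => v a))) := by
  set L := ∑ a ∈ S, c a * q m (fun _ => v a) with hL
  -- The Taylor remainder past order m is O(h^(m+1)), so it disappears after division by h^m.
  have hO : (fun h : ℝ => ∑ a ∈ S, c a * (F (h • v a) - q.partialSum (m + 1) (h • v a)))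
      =O[𝓝 0] fun h : ℝ => h ^ (m + 1) := by
    refine Asymptotics.IsBigO.fun_sum fun a _ => ?_
    refine Asymptotics.IsBigO.const_mul_left ?_ (c a)
    have h1 := hF.isBigO_sub_partialSum_pow (m + 1)
    have h2 : Tendsto (fun h : ℝ => h • v a) (𝓝 0) (𝓝 0) := by
      have : Continuous fun h : ℝ => h • v a := by fun_prop
      simpa using this.tendsto 0
    have h3 := h1.comp_tendsto h2
    simp only [Function.comp_def, zero_add] at h3
    refine h3.trans (Asymptotics.IsBigO.of_bound (‖v a‖ ^ (m + 1)) (Eventually.of_forall fun h => ?_))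
    simp only [norm_smul, norm_pow, norm_norm, mul_pow, norm_mul]
    exact (mul_comm _ _).le
  have hsum : ∀ h : ℝ, ∑ a ∈ S, c a * q.partialSum (m + 1) (h • v a) = h ^ m * L := by
    intro h
    have : ∀ a, q.partialSum (m + 1) (h • v a)
        = ∑ k ∈ Finset.range (m + 1), h ^ k * q k (fun _ => v a) := by
      intro a
      refine Finset.sum_congr rfl fun k _ => ?_
      have := (q k).map_smul_univ (fun _ => h) (fun _ => v a)
      simpa using this
    simp_rw [this, Finset.mul_sum]
    rw [Finset.sum_comm, Finset.sum_range_succ, Finset.sum_eq_zero, zero_add, hL, Finset.mul_sum]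
    · exact Finset.sum_congr rfl fun a _ => by ring
    · intro k hk
      have := h0 k (Finset.mem_range.1 hk)
      calc _ = h ^ k * ∑ a ∈ S, c a * q k (fun _ => v a) := by
            rw [Finset.mul_sum]; exact Finset.sum_congr rfl fun a _ => by ring
        _ = 0 := by rw [this, mul_zero]
  have hz : Tendsto (fun h : ℝ => (h ^ m)⁻¹ *
      ∑ a ∈ S, c a * (F (h • v a) - q.partialSum (m + 1) (h • v a))) (𝓝[≠] 0) (𝓝 0) := by
    have h1 : (fun h : ℝ => (h ^ m)⁻¹ *
        ∑ a ∈ S, c a * (F (h • v a) - q.partialSum (m + 1) (h • v a)))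
        =O[𝓝[≠] 0] fun h : ℝ => (h ^ m)⁻¹ * h ^ (m + 1) :=
      (Asymptotics.isBigO_refl _ _).mul (hO.mono nhdsWithin_le_nhds)
    refine h1.trans_tendsto ?_
    have h2 : Tendsto (fun h : ℝ => h) (𝓝[≠] 0) (𝓝 0) := tendsto_id.mono_left nhdsWithin_le_nhds
    refine h2.congr' ?_
    filter_upwards [self_mem_nhdsWithin] with h hh
    have : h ≠ 0 := hh
    rw [pow_succ, inv_mul_cancel_left₀ (pow_ne_zero _ this)]
  have := hz.add_const L
  rw [zero_add] at this
  refine this.congr' ?_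
  filter_upwards [self_mem_nhdsWithin] with h hh
  have hh : h ≠ 0 := hh
  simp_rw [mul_sub, Finset.sum_sub_distrib]
  rw [hsum h, mul_sub, inv_mul_cancel_left₀ (pow_ne_zero _ hh)]
  ring

/-- The weights of the forward difference of order `n`. -/
def diffWeight (n i : ℕ) : ℝ := (-1) ^ (n - i) * n.choose i

theorem sum_diffWeight_mul_eq_fwdDiff (f : ℝ → ℝ) (n : ℕ) :
    ∑ i ∈ Finset.range (n + 1), diffWeight n i * f i = (fwdDiff 1)^[n] f 0 := by
  rw [fwdDiff_iter_eq_sum_shift]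
  refine Finset.sum_congr rfl fun i _ => ?_
  simp [diffWeight, zsmul_eq_mul]

theorem sum_diffWeight_mul_pow_of_lt {j n : ℕ} (h : j < n) :
    ∑ i ∈ Finset.range (n + 1), diffWeight n i * (i : ℝ) ^ j = 0 := by
  rw [sum_diffWeight_mul_eq_fwdDiff (fun r => r ^ j), fwdDiff_iter_pow_eq_zero_of_lt h]
  rfl

theorem sum_diffWeight_mul_pow_self (n : ℕ) :
    ∑ i ∈ Finset.range (n + 1), diffWeight n i * (i : ℝ) ^ n = n.factorial := by
  rw [sum_diffWeight_mul_eq_fwdDiff (fun r => r ^ n), fwdDiff_iter_eq_factorial]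
  simp

theorem sum_abs_diffWeight (n : ℕ) : ∑ i ∈ Finset.range (n + 1), |diffWeight n i| = 2 ^ n := by
  have h := Nat.sum_range_choose n
  have : ∀ i, |diffWeight n i| = (n.choose i : ℝ) := by
    intro i
    simp [diffWeight, abs_mul, abs_pow]
  simp_rw [this]
  exact_mod_cast h

/-- Taylor coefficients become limits of finite combinations of values, a form to which both
Cauchy-Schwarz and measurability arguments apply. -/
theorem HasFPowerSeriesAt.tendsto_diffQuotient {f : ℝ → ℝ} {p : FormalMultilinearSeries ℝ ℝ ℝ}
    (hf : HasFPowerSeriesAt f p 0) (n : ℕ) :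
    Tendsto (fun h : ℝ => (h ^ n)⁻¹ *
        ∑ i ∈ Finset.range (n + 1), diffWeight n i * f (h * i)) (𝓝[≠] 0)
      (𝓝 (n.factorial * p.coeff n)) := by
  have key : ∀ k, ∑ i ∈ Finset.range (n + 1), diffWeight n i * p k (fun _ => (i : ℝ))
      = (∑ i ∈ Finset.range (n + 1), diffWeight n i * (i : ℝ) ^ k) * p.coeff k := by
    intro k
    rw [Finset.sum_mul]
    refine Finset.sum_congr rfl fun i _ => ?_
    rw [p.apply_eq_pow_smul_coeff, smul_eq_mul, mul_assoc]
  have := hf.tendsto_weighted_sum (Finset.range (n + 1)) (diffWeight n) (fun i : ℕ => (i : ℝ)) n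
    (fun k hk => by rw [key, sum_diffWeight_mul_pow_of_lt hk, zero_mul])
  rw [key, sum_diffWeight_mul_pow_self] at this
  simpa using this

/-- On the diagonal, q at (s, t) is a combination of monomials s^a t^b with a + b = k < 2n. So a < n
or b < n, and the difference in that variable kills the monomial. -/
theorem sum_diffWeight_mul_multilinear_eq_zero {k n : ℕ} (hk : k < 2 * n)
    (q : ContinuousMultilinearMap ℝ (fun _ : Fin k => ℝ × ℝ) ℝ) :
    ∑ a ∈ Finset.range (n + 1) ×ˢ Finset.range (n + 1),
      diffWeight n a.1 * diffWeight n a.2 * q (fun _ => ((a.1 : ℝ), (a.2 : ℝ))) = 0 := by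
  classical
  have hq : ∀ s t : ℝ, q (fun _ => (s, t)) = ∑ A : Finset (Fin k),
      s ^ A.card * t ^ Aᶜ.card * q (fun l => if l ∈ A then ((1 : ℝ), (0 : ℝ)) else (0, 1)) := by
    intro s t
    have h1 : (fun _ : Fin k => (s, t)) =
        (fun _ : Fin k => ((s, 0) : ℝ × ℝ)) + fun _ : Fin k => ((0, t) : ℝ × ℝ) := by
      ext <;> simp
    rw [h1, q.map_add_univ]
    refine Finset.sum_congr rfl fun A _ => ?_
    have h2 : A.piecewise (fun _ : Fin k => ((s, 0) : ℝ × ℝ)) (fun _ : Fin k => ((0, t) : ℝ × ℝ))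
        = fun l => (if l ∈ A then s else t) •
          (if l ∈ A then ((1 : ℝ), (0 : ℝ)) else (0, 1)) := by
      funext l
      by_cases hl : l ∈ A <;> simp [hl]
    rw [h2, q.map_smul_univ, Finset.prod_ite, Finset.prod_const, Finset.prod_const, smul_eq_mul]
    congr 4
    · ext; simp
    · ext; simp
  simp_rw [hq, Finset.mul_sum]
  rw [Finset.sum_comm]
  refine Finset.sum_eq_zero fun A _ => ?_
  set Q := q (fun l => if l ∈ A then ((1 : ℝ), (0 : ℝ)) else (0, 1))
  have hfac : ∑ a ∈ Finset.range (n + 1) ×ˢ Finset.range (n + 1),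
      diffWeight n a.1 * diffWeight n a.2 * ((a.1 : ℝ) ^ A.card * (a.2 : ℝ) ^ Aᶜ.card * Q)
      = (∑ i ∈ Finset.range (n + 1), diffWeight n i * (i : ℝ) ^ A.card) *
        (∑ i ∈ Finset.range (n + 1), diffWeight n i * (i : ℝ) ^ Aᶜ.card) * Q := by
    rw [Finset.sum_mul_sum, Finset.sum_product, Finset.sum_mul]
    refine Finset.sum_congr rfl fun i _ => ?_
    rw [Finset.sum_mul]
    exact Finset.sum_congr rfl fun j _ => by ring
  rw [hfac]
  have hcard : A.card + Aᶜ.card = k := by simp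
  rcases lt_or_ge A.card n with h | h
  · rw [sum_diffWeight_mul_pow_of_lt h]; simp
  · rw [sum_diffWeight_mul_pow_of_lt (show Aᶜ.card < n by omega)]; simp

/-- n^n / n! is a single term of the series of exp n. -/
theorem pow_self_le_exp_mul_factorial (n : ℕ) : (n : ℝ) ^ n ≤ Real.exp 1 ^ n * n.factorial := by
  have h := Real.pow_div_factorial_le_exp (n : ℝ) (Nat.cast_nonneg n) n
  rw [div_le_iff₀ (by positivity)] at h
  rwa [← Real.exp_nat_mul, mul_one]

/-- The weights contribute 2^n · 2^n and the nodes at most n^(2n). Trading n^n for e^n n! lets the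
factorials cancel later, leaving only geometric growth. -/
theorem abs_sum_diffWeight_mul_multilinear_le (n : ℕ)
    (q : ContinuousMultilinearMap ℝ (fun _ : Fin (2 * n) => ℝ × ℝ) ℝ) :
    |∑ a ∈ Finset.range (n + 1) ×ˢ Finset.range (n + 1),
      diffWeight n a.1 * diffWeight n a.2 * q (fun _ => ((a.1 : ℝ), (a.2 : ℝ)))|
      ≤ ‖q‖ * ((2 * Real.exp 1) ^ n * n.factorial) ^ 2 := by
  have hb : ∀ a ∈ Finset.range (n + 1) ×ˢ Finset.range (n + 1),
      |diffWeight n a.1 * diffWeight n a.2 * q (fun _ => ((a.1 : ℝ), (a.2 : ℝ)))|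
      ≤ |diffWeight n a.1| * |diffWeight n a.2| * (‖q‖ * ((n : ℝ) ^ n) ^ 2) := by
    intro a ha
    rw [Finset.mem_product, Finset.mem_range, Finset.mem_range] at ha
    rw [abs_mul, abs_mul]
    refine mul_le_mul_of_nonneg_left ?_ (by positivity)
    have h1 := q.le_opNorm (fun _ => ((a.1 : ℝ), (a.2 : ℝ)))
    rw [Finset.prod_const, Finset.card_univ, Fintype.card_fin, Real.norm_eq_abs] at h1
    refine h1.trans (mul_le_mul_of_nonneg_left ?_ (norm_nonneg _))
    rw [← pow_mul, mul_comm n 2]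
    refine pow_le_pow_left₀ (norm_nonneg _) ?_ _
    rw [Prod.norm_mk, Real.norm_natCast, Real.norm_natCast]
    exact max_le (by exact_mod_cast Nat.lt_succ_iff.1 ha.1)
      (by exact_mod_cast Nat.lt_succ_iff.1 ha.2)
  refine (Finset.abs_sum_le_sum_abs _ _).trans ((Finset.sum_le_sum hb).trans ?_)
  simp_rw [← Finset.sum_mul, Finset.sum_product, ← Finset.sum_mul_sum, sum_abs_diffWeight]
  have h2 := pow_self_le_exp_mul_factorial n
  calc (2 : ℝ) ^ n * 2 ^ n * (‖q‖ * ((n : ℝ) ^ n) ^ 2)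
      = ‖q‖ * (2 ^ n * (n : ℝ) ^ n) ^ 2 := by ring
    _ ≤ ‖q‖ * (2 ^ n * (Real.exp 1 ^ n * n.factorial)) ^ 2 := by gcongr
    _ = _ := by rw [mul_pow 2 (Real.exp 1) n]; ring

end Differences

/-! ### Cauchy-Schwarz for positive definite kernels -/

section PosDef

variable {D : Type*} {k : D → D → ℝ}

theorem IsPosDefKernel.symm (hk : IsPosDefKernel k) (x y : D) : k x y = k y x := by
  have := hk.1.apply x y
  simpa using this.symm

theorem IsPosDefKernel.sum_nonneg (hk : IsPosDefKernel k) {ι : Type*} [Fintype ι]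
    (c : ι → ℝ) (v : ι → D) : 0 ≤ ∑ i, ∑ j, c i * c j * k (v i) (v j) := by
  have h := (Matrix.PosSemidef.submatrix hk v).dotProduct_mulVec_nonneg c
  simp only [dotProduct, Matrix.mulVec, Finset.mul_sum] at h
  refine h.trans_eq (Finset.sum_congr rfl fun i _ => Finset.sum_congr rfl fun j _ => ?_)
  simp
  ring

/-- The Cauchy-Schwarz inequality for a positive definite kernel. -/
theorem IsPosDefKernel.sum_sq_le (hk : IsPosDefKernel k) {ι : Type*} [Fintype ι]
    (c : ι → ℝ) (v : ι → D) (x : D) :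
    (∑ i, c i * k x (v i)) ^ 2 ≤ k x x * ∑ i, ∑ j, c i * c j * k (v i) (v j) := by
  -- Adjoining x with weight t makes the form a nonnegative quadratic in t; its discriminant is then
  -- nonpositive.
  have h : ∀ t : ℝ, 0 ≤ k x x * (t * t) + 2 * (∑ i, c i * k x (v i)) * t
      + ∑ i, ∑ j, c i * c j * k (v i) (v j) := by
    intro t
    have h := hk.sum_nonneg (ι := Option ι) (fun o => o.elim t c) (fun o => o.elim x v)
    simp only [Fintype.sum_option, Option.elim_none, Option.elim_some, Finset.sum_add_distrib] at h
    refine h.trans_eq ?_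
    have e1 : ∑ i, t * c i * k x (v i) = t * ∑ i, c i * k x (v i) := by
      rw [Finset.mul_sum]; exact Finset.sum_congr rfl fun i _ => by ring
    have e2 : ∑ i, c i * t * k (v i) x = t * ∑ i, c i * k x (v i) := by
      rw [Finset.mul_sum]; exact Finset.sum_congr rfl fun i _ => by rw [hk.symm (v i) x]; ring
    rw [e1, e2]
    ring
  have := discrim_le_zero h
  rw [discrim] at this
  nlinarith

theorem IsPosDefKernel.finset_sum_sq_le (hk : IsPosDefKernel k) {ι : Type*} (S : Finset ι)
    (c : ι → ℝ) (v : ι → D) (x : D) :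
    (∑ i ∈ S, c i * k x (v i)) ^ 2
      ≤ k x x * ∑ i ∈ S, ∑ j ∈ S, c i * c j * k (v i) (v j) := by
  simpa only [Finset.sum_coe_sort S (fun i => c i * k x (v i)),
    fun i => Finset.sum_coe_sort S (fun j => c i * c j * k (v i) (v j)),
    Finset.sum_coe_sort S (fun i => ∑ j ∈ S, c i * c j * k (v i) (v j))] using
    hk.sum_sq_le (fun i : S => c i) (fun i : S => v i) x

theorem IsPosDefKernel.self_nonneg (hk : IsPosDefKernel k) (x : D) : 0 ≤ k x x := by
  simpa using hk.sum_nonneg (ι := Unit) (fun _ => 1) (fun _ => x)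

end PosDef

/-! ### Analyticity of mean embeddings along curves -/

section MeanEmbedding

variable {D : Type*} {k : D → D → ℝ}

/-- The Taylor coefficients of the sections of a positive definite kernel along a curve are bounded
by the Taylor coefficients of the kernel on the diagonal. -/
theorem IsPosDefKernel.coeff_sq_le (hk : IsPosDefKernel k) {γ : ℝ → D}
    {q : FormalMultilinearSeries ℝ (ℝ × ℝ) ℝ}
    (hq : HasFPowerSeriesAt (fun r : ℝ × ℝ => k (γ r.1) (γ r.2)) q 0) {x : D}
    {p : FormalMultilinearSeries ℝ ℝ ℝ} (hp : HasFPowerSeriesAt (fun s => k x (γ s)) p 0) (n : ℕ) :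
    p.coeff n ^ 2 ≤ k x x * (‖q (2 * n)‖ * ((2 * Real.exp 1) ^ n) ^ 2) := by
  have h1 := (hp.tendsto_diffQuotient n).pow 2
  have h2 := (hq.tendsto_weighted_sum (Finset.range (n + 1) ×ˢ Finset.range (n + 1))
    (fun a => diffWeight n a.1 * diffWeight n a.2) (fun a => ((a.1 : ℝ), (a.2 : ℝ))) (2 * n)
    (fun j hj => sum_diffWeight_mul_multilinear_eq_zero hj _)).const_mul (k x x)
  -- Cauchy-Schwarz at the nodes γ(hi), divided by h^(2n), then h → 0.
  have h3 := le_of_tendsto_of_tendsto' h1 h2 (fun h => by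
    have := hk.finset_sum_sq_le (Finset.range (n + 1)) (diffWeight n)
      (fun i : ℕ => γ (h * i)) x
    rw [mul_pow, inv_pow, ← pow_mul, mul_comm n 2, Finset.sum_product]
    calc _ ≤ (h ^ (2 * n))⁻¹ * _ := mul_le_mul_of_nonneg_left this (by
            rw [pow_mul]; positivity)
      _ = _ := by simp only [smul_eq_mul, Prod.smul_mk]; ring)
  have h4 := h3.trans (mul_le_mul_of_nonneg_left
    ((le_abs_self _).trans (abs_sum_diffWeight_mul_multilinear_le n (q (2 * n))))
    (hk.self_nonneg x))
  have hf : (0 : ℝ) < (n.factorial : ℝ) ^ 2 := by positivity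
  refine le_of_mul_le_mul_left ?_ hf
  calc _ = ((n.factorial : ℝ) * p.coeff n) ^ 2 := by ring
    _ ≤ _ := h4
    _ = _ := by ring

/-- The bound gives radius at least r, while the expansion of f is known only near 0. The identity
theorem on the interval, using analyticity of f there, extends it. -/
theorem eq_sum_of_coeff_bound {f : ℝ → ℝ} (hf : AnalyticOnNhd ℝ f Set.univ)
    {p : FormalMultilinearSeries ℝ ℝ ℝ} (hp : HasFPowerSeriesAt f p 0) {C : ℝ} {r : NNReal}
    (hr : 0 < r) (hC : ∀ n, |p.coeff n| * (r : ℝ) ^ n ≤ C) {s : ℝ} (hs : |s| < r) :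
    HasSum (fun n => s ^ n * p.coeff n) (f s) := by
  have hrad : (r : ENNReal) ≤ p.radius := by
    refine p.le_radius_of_bound C fun n => ?_
    rw [FormalMultilinearSeries.norm_apply_eq_norm_coef]
    exact hC n
  have h0 : 0 < p.radius := lt_of_lt_of_le (by exact_mod_cast hr) hrad
  have hP := p.hasFPowerSeriesOnBall h0
  have hmem : ∀ {y : ℝ}, |y| < r → y ∈ Metric.eball (0 : ℝ) r := by
    intro y hy
    rw [Metric.mem_eball, edist_zero_right, ← ofReal_norm, Real.norm_eq_abs]
    exact (ENNReal.ofReal_lt_ofReal_iff (by exact_mod_cast hr)).2 hy |>.trans_eq (by simp)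
  have heq : f =ᶠ[𝓝 0] p.sum := by
    filter_upwards [hp.eventually_hasSum, hP.hasFPowerSeriesAt.eventually_hasSum] with y h1 h2
    rw [zero_add] at h1 h2
    exact h1.unique h2
  have hev : Set.EqOn f p.sum (Metric.eball (0 : ℝ) r) := by
    refine AnalyticOnNhd.eqOn_of_preconnected_of_eventuallyEq (hf.mono (Set.subset_univ _))
      (hP.analyticOnNhd.mono (Metric.eball_subset_eball hrad)) ?_
      (Metric.mem_eball_self (by exact_mod_cast hr)) heq
    rw [Metric.eball_coe]
    exact (convex_ball _ _).isPreconnected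
  have hsum := hP.hasSum (Metric.eball_subset_eball hrad (hmem hs))
  rw [zero_add, ← hev (hmem hs)] at hsum
  refine hsum.congr_fun ?_
  intro n
  rw [p.apply_eq_pow_smul_coeff, smul_eq_mul]

/-- The mean embedding of a finite measure by a bounded analytic positive definite kernel is
analytic along curves. -/
theorem IsPosDefKernel.analyticAt_integral [MeasurableSpace D] (hk : IsPosDefKernel k) {M : ℝ}
    (hM : ∀ x, k x x ≤ M) (ν : Measure D) [IsFiniteMeasure ν] {γ : ℝ → D}
    (hmeas : ∀ s, Measurable fun x => k x (γ s))
    (hx : ∀ x, AnalyticOnNhd ℝ (fun s => k x (γ s)) Set.univ)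
    (hγ : AnalyticAt ℝ (fun r : ℝ × ℝ => k (γ r.1) (γ r.2)) 0) :
    AnalyticAt ℝ (fun s => ∫ x, k x (γ s) ∂ν) 0 := by
  obtain ⟨q, hq⟩ := hγ
  choose p hp using fun x => hx x 0 (Set.mem_univ _)
  obtain ⟨R, hR0, hR⟩ : ∃ R : NNReal, 0 < R ∧ (R : ENNReal) < q.radius := by
    obtain ⟨R, h1, h2⟩ := ENNReal.lt_iff_exists_nnreal_btwn.1 hq.radius_pos
    exact ⟨R, by exact_mod_cast h1, h2⟩
  obtain ⟨C, hC0, hC⟩ := q.norm_le_div_pow_of_pos_of_lt_radius hR0 hR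
  set B : ℝ := √(M * C) with hB
  set E : NNReal := ⟨2 * Real.exp 1, by positivity⟩ with hE
  have hE0 : 0 < E := by
    have : (0 : ℝ) < 2 * Real.exp 1 := by positivity
    exact_mod_cast this
  -- Dividing by 2e absorbs the factor (2e)^n from the coefficient bound, so ρ is a radius valid for
  -- every x.
  set ρ : NNReal := R / E with hρ
  have hρ0 : 0 < ρ := div_pos hR0 hE0
  have hbound : ∀ x n, |(p x).coeff n| * (ρ : ℝ) ^ n ≤ B := by
    intro x n
    refine Real.le_sqrt_of_sq_le ?_
    have h1 := hk.coeff_sq_le hq (hp x) n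
    have hRn : (0 : ℝ) < (R : ℝ) ^ (2 * n) := by positivity
    have h2 : k x x * (‖q (2 * n)‖ * ((2 * Real.exp 1) ^ n) ^ 2)
        ≤ M * (C / (R : ℝ) ^ (2 * n) * ((2 * Real.exp 1) ^ n) ^ 2) :=
      mul_le_mul (hM x) (mul_le_mul_of_nonneg_right (hC _) (by positivity)) (by positivity)
        ((hk.self_nonneg x).trans (hM x))
    have hEr : (E : ℝ) = 2 * Real.exp 1 := rfl
    have hEp : (0 : ℝ) < E := by exact_mod_cast hE0
    calc (|(p x).coeff n| * (ρ : ℝ) ^ n) ^ 2 = (p x).coeff n ^ 2 * ((ρ : ℝ) ^ n) ^ 2 := by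
          rw [mul_pow, sq_abs]
      _ ≤ M * (C / (R : ℝ) ^ (2 * n) * ((2 * Real.exp 1) ^ n) ^ 2) * ((ρ : ℝ) ^ n) ^ 2 :=
          mul_le_mul_of_nonneg_right (h1.trans h2) (by positivity)
      _ = M * C := by
          rw [← hEr, hρ, NNReal.coe_div, div_pow, div_pow, ← pow_mul, ← pow_mul, mul_comm n 2]
          field_simp
  have hsum : ∀ (x : D) (s : ℝ), |s| < ρ → HasSum (fun n => s ^ n * (p x).coeff n) (k x (γ s)) :=
    fun x s hs => eq_sum_of_coeff_bound (hx x) (hp x) hρ0 (hbound x) hs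
  -- The series `p x` were chosen without measurability in x; it is recovered by writing the
  -- coefficients as limits of difference quotients.
  have hcm : ∀ n, Measurable fun x => (p x).coeff n := by
    intro n
    have hseq : Tendsto (fun m : ℕ => 1 / ((m : ℝ) + 1)) atTop (𝓝[≠] 0) :=
      tendsto_nhdsWithin_iff.2 ⟨tendsto_one_div_add_atTop_nhds_zero_nat,
        Eventually.of_forall fun m => by
          simp only [Set.mem_compl_iff, Set.mem_singleton_iff]; positivity⟩
    have hf : Measurable fun x => (n.factorial : ℝ) * (p x).coeff n := by
      refine measurable_of_tendsto_metrizable (f := fun (m : ℕ) x =>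
        ((1 / ((m : ℝ) + 1)) ^ n)⁻¹ * ∑ i ∈ Finset.range (n + 1),
          diffWeight n i * k x (γ (1 / ((m : ℝ) + 1) * i))) (fun m => ?_) ?_
      · exact (Finset.measurable_fun_sum _ fun i _ => (hmeas _).const_mul _).const_mul _
      · exact tendsto_pi_nhds.2 fun x => ((hp x).tendsto_diffQuotient n).comp hseq
    simpa [Nat.factorial_ne_zero] using hf.const_mul ((n.factorial : ℝ)⁻¹)
  refine ⟨FormalMultilinearSeries.ofScalars ℝ fun n => ∫ x, (p x).coeff n ∂ν, ?_⟩
  rw [hasFPowerSeriesAt_iff]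
  have hnear : ∀ᶠ s : ℝ in 𝓝 0, |s| < ρ := by
    have : Tendsto (fun s : ℝ => |s|) (𝓝 0) (𝓝 0) := by
      simpa using (continuous_abs (G := ℝ)).tendsto 0
    exact this.eventually_lt_const (by exact_mod_cast hρ0)
  filter_upwards [hnear] with s hs
  simp only [FormalMultilinearSeries.coeff_ofScalars, smul_eq_mul, zero_add]
  have hρr : (0 : ℝ) < ρ := by exact_mod_cast hρ0
  have hle : ∀ x n, |s ^ n * (p x).coeff n| ≤ B * (|s| / ρ) ^ n := by
    intro x n
    rw [abs_mul, abs_pow, div_pow]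
    have := hbound x n
    calc |s| ^ n * |(p x).coeff n| = (|(p x).coeff n| * (ρ : ℝ) ^ n) * (|s| ^ n / (ρ : ℝ) ^ n) := by
          field_simp
      _ ≤ _ := mul_le_mul_of_nonneg_right this (by positivity)
  have hgeo : Summable fun n : ℕ => B * (|s| / ρ) ^ n :=
    (summable_geometric_of_lt_one (by positivity) ((div_lt_one hρr).2 hs)).mul_left B
  have := hasSum_integral_of_dominated_convergence (μ := ν)
    (F := fun n x => s ^ n * (p x).coeff n) (f := fun x => k x (γ s))
    (fun n _ => B * (|s| / ρ) ^ n)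
    (fun n => ((hcm n).const_mul _).aestronglyMeasurable)
    (fun n => Eventually.of_forall fun x => hle x n)
    (Eventually.of_forall fun _ => hgeo) (integrable_const _)
    (Eventually.of_forall fun x => hsum x s hs)
  simpa only [integral_const_mul] using this

end MeanEmbedding

/-! ### Zero sets of functions analytic on lines -/

section ZeroSet

/-- A function on a finite-dimensional space that is nonzero at a point and analytic on every line
through that point is nonzero almost everywhere. -/
theorem ae_ne_zero_of_analytic_on_lines {E : Type*} [NormedAddCommGroup E] [NormedSpace ℝ E]
    [FiniteDimensional ℝ E] [MeasurableSpace E] [BorelSpace E] (μ : Measure E)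
    [μ.IsAddHaarMeasure] {T : E → ℝ} (hT : Measurable T) {b : E} (hb : T b ≠ 0)
    (hline : ∀ v, AnalyticOnNhd ℝ (fun s : ℝ => T (b + s • v)) Set.univ) :
    ∀ᵐ x ∂μ, T x ≠ 0 := by
  have hray : ∀ v, ∀ᵐ s : ℝ, T (b + s • v) ≠ 0 := by
    intro v
    have h := (hline v).preimage_zero_mem_codiscrete (x := 0) (by simpa using hb)
    have h2 := ae_restrict_le_codiscreteWithin (μ := (volume : Measure ℝ)) MeasurableSet.univ h
    rw [Measure.restrict_univ] at h2
    exact h2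
  have hm : MeasurableSet {r : E × ℝ | T (b + r.2 • r.1) ≠ 0} := by
    have : Measurable fun r : E × ℝ => T (b + r.2 • r.1) := hT.comp (by fun_prop)
    exact this (measurableSet_singleton 0).compl
  have h1 : ∀ᵐ r ∂(μ.prod (volume : Measure ℝ)), T (b + r.2 • r.1) ≠ 0 :=
    (Measure.ae_prod_iff_ae_ae hm).2 (Eventually.of_forall hray)
  have h2 : ∀ᵐ s : ℝ, ∀ᵐ v ∂μ, T (b + s • v) ≠ 0 := Measure.ae_ae_comm hm |>.1
    (Measure.ae_ae_of_ae_prod h1)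
  have h3 : ∀ᵐ s : ℝ, s ≠ 0 := by simp [ae_iff]
  -- After Fubini one nonzero dilation s suffices: v ↦ b + s • v preserves null sets in both
  -- directions.
  obtain ⟨s, hs, hs0⟩ := (h2.and h3).exists
  rw [ae_iff] at hs ⊢
  have h4 := Measure.addHaar_preimage_smul μ hs0 {v | ¬ T (b + v) ≠ 0}
  have h5 : μ {v | ¬ T (b + v) ≠ 0} = 0 := by
    have h6 : (fun x => s • x) ⁻¹' {v | ¬ T (b + v) ≠ 0} = {v | ¬ T (b + s • v) ≠ 0} := rfl
    rw [h6, hs] at h4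
    rcases mul_eq_zero.1 h4.symm with h | h
    · exfalso
      have : 0 < |(s ^ Module.finrank ℝ E)⁻¹| := by positivity
      rw [ENNReal.ofReal_eq_zero] at h
      linarith
    · exact h
  have h7 := measure_preimage_add μ b {x | ¬ T x ≠ 0}
  rw [← h7]
  exact h5

end ZeroSet

/-! ### Conditional independence as an equality of laws -/

section ConditionalLaw

variable {dx dy dz : ℕ}

theorem measurable_varX : Measurable (varX : ObsSpace dx dy dz → Euc dx) := measurable_fst

theorem measurable_varY : Measurable (varY : ObsSpace dx dy dz → Euc dy) :=
  measurable_snd.comp measurable_snd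

theorem measurable_varXZ : Measurable (varXZ : ObsSpace dx dy dz → XZSpace dx dz) :=
  measurable_varX.prodMk measurable_varZ

/-- The law that `((X, Z), Y)` would have if `(X, Z)` and `Y` were conditionally independent
given `Z`, with the same conditional laws given `Z`. -/
def condIndepLaw (P : Measure (ObsSpace dx dy dz)) [IsProbabilityMeasure P] :
    Measure (LocSpace dx dy dz) :=
  (condDistrib varXZ varZ P ×ₖ condDistrib varY varZ P) ∘ₘ P.map varZ

instance (P : Measure (ObsSpace dx dy dz)) [IsProbabilityMeasure P] :
    IsProbabilityMeasure (condIndepLaw P) := by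
  have := Measure.isProbabilityMeasure_map (μ := P) measurable_varZ.aemeasurable
  unfold condIndepLaw
  infer_instance

/-- Given Z = z the second component of (X, Z) is frozen at z; uniqueness of conditional
distributions does the rest. -/
theorem condDistrib_varXZ_ae_eq (P : Measure (ObsSpace dx dy dz)) [IsProbabilityMeasure P] :
    condDistrib varXZ varZ P =ᵐ[P.map varZ] ⇑(condDistrib varX varZ P ×ₖ Kernel.id) := by
  refine condDistrib_ae_eq_of_measure_eq_compProd _ measurable_varXZ.aemeasurable ?_
  have h := compProd_map_condDistrib (mβ := inferInstance) (μ := P) (X := (varZ : ObsSpace dx dy dz → Euc dz))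
    (measurable_varX (dy := dy)).aemeasurable
  have hφ : Measurable fun r : Euc dz × Euc dx => (r.1, (r.2, r.1)) := by fun_prop
  have h1 : P.map (fun w => (varZ w, varXZ w))
      = (P.map fun w => (varZ w, varX w)).map fun r => (r.1, (r.2, r.1)) := by
    rw [Measure.map_map hφ (measurable_varZ.prodMk measurable_varX)]
    rfl
  rw [h1, ← h]
  ext s hs
  rw [Measure.map_apply hφ hs, Measure.compProd_apply (hφ hs), Measure.compProd_apply hs]
  refine lintegral_congr fun z => ?_
  rw [Kernel.prod_apply, Kernel.id_apply, Measure.prod_dirac,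
    Measure.map_apply (by fun_prop) (measurable_prodMk_left hs)]
  rfl

/-- The null hypothesis holds if and only if the law of `((X, Z), Y)` is the conditional product
law. -/
theorem nullHypothesis_iff (P : Measure (ObsSpace dx dy dz)) [IsProbabilityMeasure P] :
    NullHypothesis P ↔ P.map (fun w => (varXZ w, varY w)) = condIndepLaw P := by
  -- The standard criterion concerns the law of (Z, X, Y). The invertible reordering `e` transports
  -- it to ((X, Z), Y) without loss.
  set e : Euc dz × Euc dx × Euc dy → LocSpace dx dy dz := fun r => ((r.2.1, r.1), r.2.2) with he
  set e' : LocSpace dx dy dz → Euc dz × Euc dx × Euc dy := fun r => (r.1.2, r.1.1, r.2) with he'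
  have hem : Measurable e := by fun_prop
  have hem' : Measurable e' := by fun_prop
  have h1 : P.map (fun w => (varXZ w, varY w))
      = (P.map fun w => (varZ w, varX w, varY w)).map e := by
    rw [Measure.map_map hem (measurable_varZ.prodMk (measurable_varX.prodMk measurable_varY))]
    rfl
  have h2 : condIndepLaw P = ((Kernel.id ×ₖ (condDistrib varX varZ P ×ₖ condDistrib varY varZ P))
      ∘ₘ P.map varZ).map e := by
    rw [Measure.map_comp _ _ hem]
    refine Measure.comp_congr ?_
    filter_upwards [condDistrib_varXZ_ae_eq P] with z hz
    rw [Kernel.map_apply _ hem, Kernel.prod_apply, hz, Kernel.prod_apply, Kernel.prod_apply,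
      Kernel.prod_apply, Kernel.id_apply, Measure.prod_dirac, Measure.dirac_prod]
    have h3 := Measure.map_prod_map (condDistrib varX varZ P z) (condDistrib varY varZ P z)
      (f := fun x => (x, z)) (g := id) (by fun_prop) measurable_id
    rw [Measure.map_id] at h3
    rw [h3, Measure.map_map hem (by fun_prop)]
    rfl
  have hinv : ∀ ν : Measure (Euc dz × Euc dx × Euc dy), (ν.map e).map e' = ν := by
    intro ν
    rw [Measure.map_map hem' hem]
    exact Measure.map_id
  have h0 := condIndepFun_iff_map_prod_eq_prod_condDistrib_prod_condDistrib (μ := P)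
    (measurable_varX (dx := dx) (dy := dy) (dz := dz)) measurable_varY measurable_varZ
  unfold NullHypothesis
  rw [h0, h1, h2]
  refine ⟨fun h => by rw [h], fun h => ?_⟩
  rw [← hinv (P.map _), h, hinv]

end ConditionalLaw

/-! ### Consequences of the kernel assumption -/

section Kernel

variable {dx dy dz : ℕ} {k : LocSpace dx dy dz → LocSpace dx dy dz → ℝ}
  {kX : XZSpace dx dz → XZSpace dx dz → ℝ} {kY : Euc dy → Euc dy → ℝ}

/-- A zero kernel would embed all measures alike, yet dx ≥ 1 provides two distinct Dirac measures.
-/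
theorem KernelAssumption.exists_ne_zero (hdx : 1 ≤ dx) (hk : KernelAssumption k kX kY) :
    ∃ s t, k s t ≠ 0 := by
  by_contra! h
  have : Nonempty (Fin dx) := ⟨⟨0, hdx⟩⟩
  obtain ⟨x, hx⟩ := exists_ne (0 : Euc dx)
  have h1 := hk.characteristic (Measure.dirac 0) (Measure.dirac ((x, 0), 0)) inferInstance
    inferInstance (by funext t; simp [meanEmbedding, h])
  have h2 : ((0 : Euc dx), (0 : Euc dz)) = (x, 0) := by
    have := (dirac_eq_dirac_iff (x := (0 : LocSpace dx dy dz)) (y := ((x, 0), 0))).1 h1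
    exact congrArg Prod.fst this
  exact hx (congrArg Prod.fst h2).symm

/-- Boundedness and continuity are assumed for the product only. Freezing the Y-arguments where `kY`
is nonzero exhibits `kX` as a constant multiple of a section of k. -/
theorem KernelAssumption.bounded_continuous_left (hdx : 1 ≤ dx) (hk : KernelAssumption k kX kY) :
    (∃ C : ℝ, ∀ a a', |kX a a'| ≤ C) ∧ Continuous fun q : XZSpace dx dz × XZSpace dx dz =>
      kX q.1 q.2 := by
  obtain ⟨s, t, hst⟩ := hk.exists_ne_zero hdx
  have hkt : ∀ s t, k s t = kX s.1 t.1 * kY s.2 t.2 := fun s t => by rw [hk.tensor]; rfl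
  rw [hkt] at hst
  have hY : kY s.2 t.2 ≠ 0 := right_ne_zero_of_mul hst
  have he : ∀ a a', kX a a' = k (a, s.2) (a', t.2) * (kY s.2 t.2)⁻¹ := fun a a' => by
    rw [hkt, mul_inv_cancel_right₀ hY]
  obtain ⟨C, hC⟩ := hk.bounded
  refine ⟨⟨C * |(kY s.2 t.2)⁻¹|, fun a a' => ?_⟩, ?_⟩
  · rw [he, abs_mul]
    exact mul_le_mul_of_nonneg_right (hC _ _) (abs_nonneg _)
  · simp_rw [he]
    exact (hk.continuous.comp (f := fun q : XZSpace dx dz × XZSpace dx dz =>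
      ((q.1, s.2), (q.2, t.2))) (by fun_prop)).mul continuous_const

theorem KernelAssumption.bounded_continuous_right (hdx : 1 ≤ dx) (hk : KernelAssumption k kX kY) :
    (∃ C : ℝ, ∀ b b', |kY b b'| ≤ C) ∧ Continuous fun q : Euc dy × Euc dy => kY q.1 q.2 := by
  obtain ⟨s, t, hst⟩ := hk.exists_ne_zero hdx
  have hkt : ∀ s t, k s t = kX s.1 t.1 * kY s.2 t.2 := fun s t => by rw [hk.tensor]; rfl
  rw [hkt] at hst
  have hX : kX s.1 t.1 ≠ 0 := left_ne_zero_of_mul hst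
  have he : ∀ b b', kY b b' = k (s.1, b) (t.1, b') * (kX s.1 t.1)⁻¹ := fun b b' => by
    rw [hkt, mul_comm (kX s.1 t.1), mul_inv_cancel_right₀ hX]
  obtain ⟨C, hC⟩ := hk.bounded
  refine ⟨⟨C * |(kX s.1 t.1)⁻¹|, fun b b' => ?_⟩, ?_⟩
  · rw [he, abs_mul]
    exact mul_le_mul_of_nonneg_right (hC _ _) (abs_nonneg _)
  · simp_rw [he]
    exact (hk.continuous.comp (f := fun q : Euc dy × Euc dy =>
      ((s.1, q.1), (t.1, q.2))) (by fun_prop)).mul continuous_const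

theorem KernelAssumption.integral_line_analytic (hk : KernelAssumption k kX kY)
    (ν : Measure (LocSpace dx dy dz)) [IsFiniteMeasure ν] (b v : LocSpace dx dy dz) :
    AnalyticOnNhd ℝ (fun s : ℝ => ∫ x, k x (b + s • v) ∂ν) Set.univ := by
  obtain ⟨C, hC⟩ := hk.bounded
  intro s₀ _
  -- Recentre at s₀, since analyticity of the integral is available at parameter 0.
  have hγ : AnalyticOnNhd ℝ (fun s : ℝ => b + (s₀ + s) • v) Set.univ := by
    intro s _
    fun_prop
  have h := hk.posDef.analyticAt_integral (fun x => (le_abs_self _).trans (hC x x)) ν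
    (γ := fun s => b + (s₀ + s) • v)
    (fun s => (hk.continuous.comp (f := fun x => (x, b + (s₀ + s) • v))
      (by fun_prop)).measurable)
    (fun x s _ => AnalyticAt.fun_comp (f := fun s : ℝ => (x, b + (s₀ + s) • v))
      (hk.analytic _ (Set.mem_univ _)) (analyticAt_const.prod (hγ s (Set.mem_univ _))))
    (AnalyticAt.fun_comp (f := fun r : ℝ × ℝ => (b + (s₀ + r.1) • v, b + (s₀ + r.2) • v))
      (hk.analytic _ (Set.mem_univ _))
      (((hγ _ (Set.mem_univ _)).fun_comp analyticAt_fst).prod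
        ((hγ _ (Set.mem_univ _)).fun_comp analyticAt_snd)))
  have h2 := AnalyticAt.fun_comp_of_eq (f := fun s : ℝ => s - s₀) (x := s₀) h (by fun_prop)
    (sub_self s₀)
  simpa using h2

end Kernel

/-! ### The mean of the oracle term -/

section OracleTerm

variable {dx dy dz : ℕ} {k : LocSpace dx dy dz → LocSpace dx dy dz → ℝ}
  {kX : XZSpace dx dz → XZSpace dx dz → ℝ} {kY : Euc dy → Euc dy → ℝ}
  (P : Measure (ObsSpace dx dy dz)) [IsProbabilityMeasure P]

/-- Tower property, by disintegrating the law of (Z, U); the bounds supply integrability. -/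
theorem integral_mul_comp_eq_condDistrib {Ω A B : Type*} [MeasurableSpace Ω] [MeasurableSpace A]
    [StandardBorelSpace A] [Nonempty A] [MeasurableSpace B] (μ : Measure Ω) [IsProbabilityMeasure μ]
    {U : Ω → A} {Z : Ω → B} (hU : Measurable U) (hZ : Measurable Z) {f : A → ℝ} (hf : Measurable f)
    {g : B → ℝ} (hg : Measurable g) {C C' : ℝ} (hfC : ∀ a, |f a| ≤ C) (hgC : ∀ b, |g b| ≤ C') :
    ∫ w, f (U w) * g (Z w) ∂μ = ∫ w, (∫ a, f a ∂(condDistrib U Z μ (Z w))) * g (Z w) ∂μ := by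
  have := Measure.isProbabilityMeasure_map (μ := μ) hZ.aemeasurable
  have hint : Integrable (fun r : B × A => f r.2 * g r.1) (μ.map Z ⊗ₘ condDistrib U Z μ) := by
    refine Integrable.of_bound (by fun_prop) (C * C') (Eventually.of_forall fun r => ?_)
    rw [Real.norm_eq_abs, abs_mul]
    exact mul_le_mul (hfC _) (hgC _) (abs_nonneg _) ((abs_nonneg _).trans (hfC r.2))
  have h1 := Measure.integral_compProd hint
  rw [compProd_map_condDistrib hU.aemeasurable,
    integral_map (hZ.prodMk hU).aemeasurable (by fun_prop)] at h1
  rw [h1]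
  simp_rw [integral_mul_const]
  have hm : StronglyMeasurable fun z => ∫ a, f a ∂(condDistrib U Z μ z) :=
    hf.stronglyMeasurable.integral_kernel
  exact integral_map (f := fun z => (∫ a, f a ∂(condDistrib U Z μ z)) * g z) hZ.aemeasurable
    (hm.measurable.mul hg).aestronglyMeasurable

theorem measurable_condMeanXZ {t : XZSpace dx dz} (h : Measurable (kX t)) :
    Measurable (condMeanXZ P kX t) :=
  h.stronglyMeasurable.integral_kernel.measurable

theorem measurable_condMeanY {t : Euc dy} (h : Measurable (kY t)) :
    Measurable (condMeanY P kY t) :=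
  h.stronglyMeasurable.integral_kernel.measurable

theorem abs_integral_le_of_abs_le {A : Type*} [MeasurableSpace A] (ν : Measure A)
    [IsProbabilityMeasure ν] {f : A → ℝ} {C : ℝ} (h : ∀ a, |f a| ≤ C) : |∫ a, f a ∂ν| ≤ C := by
  simpa using norm_integral_le_of_norm_le_const (μ := ν) (f := f) (C := C)
    (Eventually.of_forall h)

theorem KernelAssumption.measurable_oracleTerm (hdx : 1 ≤ dx) (hk : KernelAssumption k kX kY)
    (t : LocSpace dx dy dz) : Measurable (oracleTerm P kX kY t) := by
  have hX : Measurable (kX t.1) := ((hk.bounded_continuous_left hdx).2.comp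
    (f := fun a => (t.1, a)) (by fun_prop)).measurable
  have hY : Measurable (kY t.2) := ((hk.bounded_continuous_right hdx).2.comp
    (f := fun a => (t.2, a)) (by fun_prop)).measurable
  exact ((hX.comp measurable_varXZ).sub ((measurable_condMeanXZ P hX).comp measurable_varZ)).mul
    ((hY.comp measurable_varY).sub ((measurable_condMeanY P hY).comp measurable_varZ))

theorem KernelAssumption.bounded_oracleTerm (hdx : 1 ≤ dx) (hk : KernelAssumption k kX kY) :
    ∃ C, ∀ (t : LocSpace dx dy dz) w, |oracleTerm P kX kY t w| ≤ C := by
  obtain ⟨C, hC⟩ := (hk.bounded_continuous_left hdx).1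
  obtain ⟨C', hC'⟩ := (hk.bounded_continuous_right hdx).1
  refine ⟨(C + C) * (C' + C'), fun t w => ?_⟩
  rw [oracleTerm, abs_mul]
  have h1 : |kX t.1 (varXZ w) - condMeanXZ P kX t.1 (varZ w)| ≤ C + C :=
    (abs_sub _ _).trans (add_le_add (hC _ _) (abs_integral_le_of_abs_le _ fun a => hC _ _))
  have h2 : |kY t.2 (varY w) - condMeanY P kY t.2 (varZ w)| ≤ C' + C' :=
    (abs_sub _ _).trans (add_le_add (hC' _ _) (abs_integral_le_of_abs_le _ fun a => hC' _ _))
  exact mul_le_mul h1 h2 (abs_nonneg _) ((abs_nonneg _).trans h1)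

/-- The mean of the oracle term is the difference of two mean embeddings. -/
theorem KernelAssumption.integral_oracleTerm (hdx : 1 ≤ dx) (hk : KernelAssumption k kX kY)
    (t : LocSpace dx dy dz) :
    ∫ w, oracleTerm P kX kY t w ∂P
      = meanEmbedding k (P.map fun w => (varXZ w, varY w)) t
        - meanEmbedding k (condIndepLaw P) t := by
  obtain ⟨C, hC⟩ := (hk.bounded_continuous_left hdx).1
  obtain ⟨C', hC'⟩ := (hk.bounded_continuous_right hdx).1
  have hX : Measurable (kX t.1) := ((hk.bounded_continuous_left hdx).2.comp
    (f := fun a => (t.1, a)) (by fun_prop)).measurable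
  have hY : Measurable (kY t.2) := ((hk.bounded_continuous_right hdx).2.comp
    (f := fun a => (t.2, a)) (by fun_prop)).measurable
  have hmX := measurable_condMeanXZ P hX
  have hmY := measurable_condMeanY P hY
  have bX : ∀ z, |condMeanXZ P kX t.1 z| ≤ C := fun z => abs_integral_le_of_abs_le _ fun a => hC _ _
  have bY : ∀ z, |condMeanY P kY t.2 z| ≤ C' := fun z =>
    abs_integral_le_of_abs_le _ fun a => hC' _ _
  have hint : ∀ f g : ObsSpace dx dy dz → ℝ, Measurable f → Measurable g → (∀ w, |f w| ≤ C) →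
      (∀ w, |g w| ≤ C') → Integrable (fun w => f w * g w) P := by
    intro f g hf hg hfC hgC
    refine Integrable.of_bound (by fun_prop) (C * C') (Eventually.of_forall fun r => ?_)
    rw [Real.norm_eq_abs, abs_mul]
    exact mul_le_mul (hfC _) (hgC _) (abs_nonneg _) ((abs_nonneg _).trans (hfC r))
  have mA : Measurable fun w : ObsSpace dx dy dz => kX t.1 (varXZ w) := hX.comp measurable_varXZ
  have mB : Measurable fun w : ObsSpace dx dy dz => kY t.2 (varY w) := hY.comp measurable_varY
  have mm : Measurable fun w : ObsSpace dx dy dz => condMeanXZ P kX t.1 (varZ w) :=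
    hmX.comp measurable_varZ
  have mm' : Measurable fun w : ObsSpace dx dy dz => condMeanY P kY t.2 (varZ w) :=
    hmY.comp measurable_varZ
  have i1 := hint _ _ mA mB (fun w => hC _ _) (fun w => hC' _ _)
  have i2 := hint _ _ mA mm' (fun w => hC _ _) (fun w => bY _)
  have i3 := hint _ _ mm mB (fun w => bX _) (fun w => hC' _ _)
  have i4 := hint _ _ mm mm' (fun w => bX _) (fun w => bY _)
  -- By the tower property both cross terms equal the mean of the product of conditional means, so
  -- the four-term expansion collapses to two.
  have e2 : ∫ w, kX t.1 (varXZ w) * condMeanY P kY t.2 (varZ w) ∂P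
      = ∫ w, condMeanXZ P kX t.1 (varZ w) * condMeanY P kY t.2 (varZ w) ∂P :=
    integral_mul_comp_eq_condDistrib P measurable_varXZ measurable_varZ hX hmY (hC _) bY
  have e3 : ∫ w, condMeanXZ P kX t.1 (varZ w) * kY t.2 (varY w) ∂P
      = ∫ w, condMeanXZ P kX t.1 (varZ w) * condMeanY P kY t.2 (varZ w) ∂P := by
    have := integral_mul_comp_eq_condDistrib P measurable_varY measurable_varZ hY hmX (hC' _) bX
    simp_rw [mul_comm (condMeanXZ P kX t.1 _)]
    exact this
  have hkt : ∀ s, k s t = kX t.1 s.1 * kY t.2 s.2 := fun s => by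
    rw [hk.posDef.symm, hk.tensor]; rfl
  have hmk : Measurable fun s : LocSpace dx dy dz => kX t.1 s.1 * kY t.2 s.2 :=
    (hX.comp measurable_fst).mul (hY.comp measurable_snd)
  have f1 : meanEmbedding k (P.map fun w => (varXZ w, varY w)) t
      = ∫ w, kX t.1 (varXZ w) * kY t.2 (varY w) ∂P := by
    simp only [meanEmbedding, hkt]
    exact integral_map (measurable_varXZ.prodMk measurable_varY).aemeasurable
      hmk.aestronglyMeasurable
  have f2 : meanEmbedding k (condIndepLaw P) t
      = ∫ w, condMeanXZ P kX t.1 (varZ w) * condMeanY P kY t.2 (varZ w) ∂P := by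
    have := Measure.isProbabilityMeasure_map (μ := P) measurable_varZ.aemeasurable
    simp only [meanEmbedding, hkt]
    rw [condIndepLaw, ← Measure.snd_compProd, Measure.snd,
      integral_map measurable_snd.aemeasurable hmk.aestronglyMeasurable]
    rw [Measure.integral_compProd]
    · rw [← integral_map (f := fun z => condMeanXZ P kX t.1 z * condMeanY P kY t.2 z)
        measurable_varZ.aemeasurable (hmX.mul hmY).aestronglyMeasurable]
      refine integral_congr_ae (Eventually.of_forall fun z => ?_)
      simp only [Kernel.prod_apply]
      exact integral_prod_mul (kX t.1) (kY t.2)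
    · refine Integrable.of_bound (hmk.comp measurable_snd).aestronglyMeasurable (C * C')
        (Eventually.of_forall fun r => ?_)
      rw [Real.norm_eq_abs, abs_mul]
      exact mul_le_mul (hC _ _) (hC' _ _) (abs_nonneg _) ((abs_nonneg _).trans (hC t.1 r.2.1))
  rw [f1, f2]
  have : ∀ w, oracleTerm P kX kY t w = kX t.1 (varXZ w) * kY t.2 (varY w)
      - kX t.1 (varXZ w) * condMeanY P kY t.2 (varZ w)
      - (condMeanXZ P kX t.1 (varZ w) * kY t.2 (varY w)
        - condMeanXZ P kX t.1 (varZ w) * condMeanY P kY t.2 (varZ w)) := fun w => by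
    rw [oracleTerm]; ring
  simp_rw [this]
  rw [integral_sub (by exact i1.sub i2) (by exact i3.sub i4), integral_sub i1 i2,
    integral_sub i3 i4, e2, e3, sub_self, sub_zero]

theorem KernelAssumption.integral_oracleTerm_of_null (hdx : 1 ≤ dx)
    (hk : KernelAssumption k kX kY) (hP : NullHypothesis P) (t : LocSpace dx dy dz) :
    ∫ w, oracleTerm P kX kY t w ∂P = 0 := by
  rw [hk.integral_oracleTerm P hdx, (nullHypothesis_iff P).1 hP, sub_self]

theorem KernelAssumption.ae_integral_oracleTerm_ne_zero (hdx : 1 ≤ dx)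
    (hk : KernelAssumption k kX kY) (hP : ¬ NullHypothesis P) :
    ∀ᵐ t : LocSpace dx dy dz, ∫ w, oracleTerm P kX kY t w ∂P ≠ 0 := by
  have hprob := Measure.isProbabilityMeasure_map (μ := P)
    (measurable_varXZ.prodMk measurable_varY).aemeasurable
  set P' := P.map fun w => (varXZ w, varY w) with hP'
  simp_rw [hk.integral_oracleTerm P hdx]
  have hmeas : ∀ ν : Measure (LocSpace dx dy dz), IsProbabilityMeasure ν →
      Measurable (meanEmbedding k ν) := by
    intro ν _
    have : StronglyMeasurable (Function.uncurry fun t x : LocSpace dx dy dz => k x t) :=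
      (hk.continuous.comp continuous_swap).stronglyMeasurable
    exact this.integral_prod_right.measurable
  -- Were the embeddings equal everywhere, characteristicness would identify the laws and force H₀.
  obtain ⟨b, hb⟩ : ∃ b, meanEmbedding k P' b - meanEmbedding k (condIndepLaw P) b ≠ 0 := by
    by_contra! h
    exact hP ((nullHypothesis_iff P).2 (hk.characteristic _ _ hprob inferInstance
      (funext fun t => sub_eq_zero.1 (h t))))
  have hXZ : (volume : Measure (XZSpace dx dz)).IsAddHaarMeasure :=
    Measure.prod.instIsAddHaarMeasure (volume : Measure (Euc dx)) (volume : Measure (Euc dz))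
  have hLoc : (volume : Measure (LocSpace dx dy dz)).IsAddHaarMeasure :=
    Measure.prod.instIsAddHaarMeasure (volume : Measure (XZSpace dx dz))
      (volume : Measure (Euc dy))
  exact ae_ne_zero_of_analytic_on_lines volume
    ((hmeas P' hprob).sub (hmeas (condIndepLaw P) inferInstance)) hb fun v =>
    (hk.integral_line_analytic P' b v).sub (hk.integral_line_analytic (condIndepLaw P) b v)

end OracleTerm

/-! ### Multivariate central limit theorem -/

section CentralLimit

-- This identity serves twice: it makes Σ positive semidefinite, and it identifies the variance of
-- the projection of u on v.
open Matrix in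
theorem dotProduct_secondMoment_mulVec {A : Type*} [MeasurableSpace A] (ν : Measure A) {J : ℕ}
    (u : Fin J → A → ℝ) (hu : ∀ j l, Integrable (fun a => u j a * u l a) ν) (v : Fin J → ℝ) :
    v ⬝ᵥ (Matrix.of fun j l => ∫ a, u j a * u l a ∂ν) *ᵥ v = ∫ a, (∑ j, u j a * v j) ^ 2 ∂ν := by
  have h : ∀ a, (∑ j, u j a * v j) ^ 2 = ∑ j, ∑ l, v j * v l * (u j a * u l a) := by
    intro a
    rw [sq, Finset.sum_mul_sum]
    exact Finset.sum_congr rfl fun j _ => Finset.sum_congr rfl fun l _ => by ring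
  simp_rw [h]
  rw [integral_finsetSum _ fun j _ => integrable_finsetSum _ fun l _ => (hu j l).const_mul _]
  simp only [dotProduct, mulVec, Matrix.of_apply, Finset.mul_sum]
  refine Finset.sum_congr rfl fun j _ => ?_
  rw [integral_finsetSum _ fun l _ => (hu j l).const_mul _]
  refine Finset.sum_congr rfl fun l _ => ?_
  rw [integral_const_mul]
  ring

/-- The multivariate central limit theorem for centred bounded observables of an i.i.d. sequence. -/
theorem tendstoInDistribution_multivariateGaussian {A Ω : Type*} [MeasurableSpace A]
    [MeasurableSpace Ω] (μ : Measure Ω) [IsProbabilityMeasure μ] (ν : Measure A)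
    [IsProbabilityMeasure ν] {W : ℕ → Ω → A} (hindep : iIndepFun W μ)
    (hlaw : ∀ i, HasLaw (W i) ν μ) {J : ℕ} {u : Fin J → A → ℝ} (hu : ∀ j, Measurable (u j))
    {C : ℝ} (hC : ∀ j a, |u j a| ≤ C) (h0 : ∀ j, ∫ a, u j a ∂ν = 0)
    (hS : (Matrix.of fun j l => ∫ a, u j a * u l a ∂ν).PosSemidef) :
    TendstoInDistribution
      (fun (n : ℕ) (ω : Ω) => (WithLp.toLp 2 fun j => (√(n : ℝ))⁻¹ *
        ∑ i ∈ Finset.range n, u j (W i ω) : EuclideanSpace ℝ (Fin J))) atTop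
      (id : EuclideanSpace ℝ (Fin J) → EuclideanSpace ℝ (Fin J)) (fun _ => μ)
      (multivariateGaussian 0 (Matrix.of fun j l => ∫ a, u j a * u l a ∂ν)) := by
  set S := Matrix.of fun j l => ∫ a, u j a * u l a ∂ν
  have hint : ∀ j, Integrable (u j) ν := fun j =>
    Integrable.of_bound (hu j).aestronglyMeasurable C (Eventually.of_forall (hC j))
  have hint2 : ∀ j l, Integrable (fun a => u j a * u l a) ν := fun j l =>
    (hint l).bdd_mul (hu j).aestronglyMeasurable (Eventually.of_forall (hC j))
  have hW : ∀ i, AEMeasurable (W i) μ := fun i => (hlaw i).aemeasurable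
  have hmeas : ∀ n : ℕ, AEMeasurable (fun ω => (WithLp.toLp 2 fun j => (√(n : ℝ))⁻¹ *
      ∑ i ∈ Finset.range n, u j (W i ω) : EuclideanSpace ℝ (Fin J))) μ := by
    intro n
    refine (WithLp.measurable_toLp 2 _).comp_aemeasurable (aemeasurable_pi_lambda _ fun j => ?_)
    exact (Finset.aemeasurable_fun_sum _ fun i _ => (hu j).comp_aemeasurable (hW i)).const_mul _
  refine ⟨hmeas, aemeasurable_id, ?_⟩
  refine ProbabilityMeasure.tendsto_iff_tendsto_charFun.2 fun v => ?_
  -- Cramér-Wold: the characteristic function of the vector at v is that of the normalised sum of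
  -- the scalars f(W i) at 1.
  set f : A → ℝ := fun a => ∑ j, u j a * v j with hf
  have hfm : Measurable f := Finset.measurable_fun_sum _ fun j _ => (hu j).mul_const _
  have hf0 : ∫ a, f a ∂ν = 0 := by
    rw [hf, integral_finsetSum _ fun j _ => (hint j).mul_const _]
    exact Finset.sum_eq_zero fun j _ => by rw [integral_mul_const, h0, zero_mul]
  have hfC : ∀ a, ‖f a‖ ≤ ∑ j, C * |v j| := fun a =>
    (Finset.abs_sum_le_sum_abs _ _).trans (Finset.sum_le_sum fun j _ => by
      rw [abs_mul]; exact mul_le_mul_of_nonneg_right (hC j a) (abs_nonneg _))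
  have hfW : ∀ i, HasLaw (fun ω => f (W i ω)) (ν.map f) μ := fun i =>
    ⟨hfm.comp_aemeasurable (hW i), by
      rw [← (hlaw i).map_eq, AEMeasurable.map_map_of_aemeasurable hfm.aemeasurable (hW i)]; rfl⟩
  have hmean : μ[fun ω => f (W 0 ω)] = 0 := by
    have := (hlaw 0).integral_comp hfm.aestronglyMeasurable
    rw [← hf0, ← this]; rfl
  have hvar : Var[fun ω => f (W 0 ω); μ] = ∫ a, f a ^ 2 ∂ν := by
    rw [variance_of_integral_eq_zero (hfW 0).aemeasurable hmean]
    exact (hlaw 0).integral_comp (hfm.pow_const 2).aestronglyMeasurable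
  have hclt := tendstoInDistribution_inv_sqrt_mul_sum_sub (P := μ)
    (X := fun i ω => f (W i ω)) HasLaw.id
    (MemLp.of_bound (hfW 0).aemeasurable.aestronglyMeasurable _
      (Eventually.of_forall fun ω => hfC _))
    (hindep.comp (fun _ => f) fun _ => hfm) (fun i => (hfW i).identDistrib (hfW 0))
  have h1 := ProbabilityMeasure.tendsto_iff_tendsto_charFun.1 hclt.tendsto 1
  simp only [ProbabilityMeasure.coe_mk, Measure.map_id, charFun_gaussianReal] at h1 ⊢
  rw [charFun_multivariateGaussian hS]
  have hlim : ((∫ a, f a ^ 2 ∂ν : ℝ) : ℂ)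
      = ((v.ofLp ⬝ᵥ S.mulVec v.ofLp : ℝ) : ℂ) := by
    rw [dotProduct_secondMoment_mulVec ν u hint2]
  rw [hvar] at h1
  refine (h1.congr fun n => ?_).trans_eq ?_
  · rw [charFun_apply, charFun_apply, integral_map (hclt.forall_aemeasurable n)
        (Continuous.aestronglyMeasurable (by fun_prop)),
      integral_map (hmeas n) (by fun_prop)]
    refine integral_congr_ae (Eventually.of_forall fun ω => ?_)
    have hin : (inner ℝ ((√(n : ℝ))⁻¹ * (∑ i ∈ Finset.range n, f (W i ω) - n * 0)) (1 : ℝ) : ℝ)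
        = inner ℝ (WithLp.toLp 2 fun j => (√(n : ℝ))⁻¹ *
          ∑ i ∈ Finset.range n, u j (W i ω) : EuclideanSpace ℝ (Fin J)) v := by
      simp only [PiLp.inner_apply, RCLike.inner_apply, conj_trivial, hf, mul_zero, sub_zero,
        one_mul]
      rw [Finset.sum_comm, Finset.mul_sum]
      refine Finset.sum_congr rfl fun j _ => ?_
      rw [← Finset.sum_mul]
      ring
    simp only [hmean] at hin ⊢
    rw [hin]
  · have hnn : 0 ≤ ∫ a, f a ^ 2 ∂ν := integral_nonneg fun a => sq_nonneg _
    rw [← hlim]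
    simp [Real.coe_toNNReal _ hnn]

end CentralLimit

/-! ### From almost sure divergence to probability one -/

section Consistency

/-- If an event holds eventually almost surely then its probability tends to one. -/
theorem tendsto_measure_one_of_ae_eventually {Ω : Type*} [MeasurableSpace Ω] (μ : Measure Ω)
    [IsProbabilityMeasure μ] {s : ℕ → Set Ω} (h : ∀ᵐ ω ∂μ, ∀ᶠ n in atTop, ω ∈ s n) :
    Tendsto (fun n => μ (s n)) atTop (𝓝 1) := by
  -- These events increase to a set of full measure and B N ⊆ s N, so continuity from below applies.
  set B : ℕ → Set Ω := fun N => ⋂ n ≥ N, s n with hB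
  have hmono : Monotone B := fun N M hNM =>
    Set.biInter_subset_biInter_left fun n (hn : n ≥ M) => hNM.trans hn
  have hU : μ (⋃ N, B N) = 1 := by
    refine (measure_of_measure_compl_eq_zero (mem_ae_iff.1 ?_)).trans measure_univ
    filter_upwards [h] with ω hω
    obtain ⟨N, hN⟩ := eventually_atTop.1 hω
    exact Set.mem_iUnion.2 ⟨N, Set.mem_iInter₂.2 hN⟩
  have := tendsto_measure_iUnion_atTop (μ := μ) hmono
  rw [hU] at this
  exact tendsto_of_tendsto_of_tendsto_of_le_of_le this tendsto_const_nhds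
    (fun N => measure_mono (Set.biInter_subset_of_mem (le_refl N))) fun N => prob_le_one

end Consistency

/-! ### Limits under the null and the alternative -/

theorem mainTheorem3
    {dx dy dz : ℕ} (hdx : 1 ≤ dx) (hdy : 1 ≤ dy) (hdz : 1 ≤ dz)
    (k : LocSpace dx dy dz → LocSpace dx dy dz → ℝ)
    (kX : XZSpace dx dz → XZSpace dx dz → ℝ) (kY : Euc dy → Euc dy → ℝ)
    (hk : KernelAssumption k kX kY)
    (P : Measure (ObsSpace dx dy dz)) [IsProbabilityMeasure P]
    {Ω : Type*} [MeasurableSpace Ω] (μ : Measure Ω) [IsProbabilityMeasure μ]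
    (W : ℕ → Ω → ObsSpace dx dy dz)
    (hW_indep : iIndepFun W μ) (hW_law : ∀ i, HasLaw (W i) P μ)
    (p : ℝ) (hp : 1 ≤ p) (J : ℕ) (hJ : 1 ≤ J) :
    (NullHypothesis P → ∀ t : Fin J → LocSpace dx dy dz,
      (∀ j l, Integrable
        (fun w => oracleTerm P kX kY (t j) w * oracleTerm P kX kY (t l) w) P) ∧
      (oracleCov P kX kY t).PosSemidef ∧
      TendstoInDistribution
        (fun (n : ℕ) (ω : Ω) => √(n : ℝ) • oracleS P kX kY t (fun i => W i ω) n) atTop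
        (id : EuclideanSpace ℝ (Fin J) → EuclideanSpace ℝ (Fin J)) (fun _ => μ)
        (multivariateGaussian 0 (oracleCov P kX kY t))) ∧
    (¬ NullHypothesis P → ∀ Γ : Measure (LocSpace dx dy dz), IsProbabilityMeasure Γ →
      Γ ≪ volume →
      ∀ᵐ t ∂(Measure.pi fun _ : Fin J => Γ), ∀ q : ℝ,
        Tendsto
          (fun n : ℕ => μ {ω | q ≤ (n : ℝ) ^ (p / 2) * oracleCI P kX kY t p (fun i => W i ω) n})
          atTop (𝓝 1)) := by
  obtain ⟨C, hC⟩ := hk.bounded_oracleTerm P hdx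
  have hm := hk.measurable_oracleTerm P hdx
  have hint : ∀ t, Integrable (oracleTerm P kX kY t) P := fun t =>
    Integrable.of_bound (hm t).aestronglyMeasurable C (Eventually.of_forall (hC t))
  have hint2 : ∀ s t, Integrable (fun w => oracleTerm P kX kY s w * oracleTerm P kX kY t w) P :=
    fun s t => (hint t).bdd_mul (hm s).aestronglyMeasurable (Eventually.of_forall (hC s))
  refine ⟨fun hP t => ?_, fun hP Γ hΓ hac => ?_⟩
  · have hS : (oracleCov P kX kY t).PosSemidef := by
      refine Matrix.PosSemidef.of_dotProduct_mulVec_nonneg ?_ fun v => ?_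
      · ext j l
        simp [oracleCov, mul_comm]
      · rw [star_trivial, oracleCov,
          dotProduct_secondMoment_mulVec P (fun j => oracleTerm P kX kY (t j)) fun j l => hint2 _ _]
        exact integral_nonneg fun w => sq_nonneg _
    refine ⟨fun j l => hint2 _ _, hS, ?_⟩
    have h := tendstoInDistribution_multivariateGaussian μ P hW_indep hW_law
      (u := fun j => oracleTerm P kX kY (t j)) (fun j => hm _) (fun j => hC _)
      (fun j => hk.integral_oracleTerm_of_null P hdx hP _) hS
    have heq : (fun (n : ℕ) (ω : Ω) => √(n : ℝ) • oracleS P kX kY t (fun i => W i ω) n)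
        = fun (n : ℕ) (ω : Ω) => (WithLp.toLp 2 fun j => (√(n : ℝ))⁻¹ *
          ∑ i ∈ Finset.range n, oracleTerm P kX kY (t j) (W i ω) :
            EuclideanSpace ℝ (Fin J)) := by
      funext n ω
      ext j
      simp only [oracleS, oracleDelta, PiLp.smul_apply, smul_eq_mul]
      -- √n / n = 1/√n holds at n = 0 too, both sides being 0 by convention.
      rw [← mul_assoc, mul_one_div, Real.sqrt_div_self', one_div]
    rw [heq]
    exact h
  · have h1 := hac.ae_le (hk.ae_integral_oracleTerm_ne_zero P hdx hP)
    -- A single location with nonzero mean suffices, since every summand of the statistic is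
    -- nonnegative; J ≥ 1 supplies index 0.
    have h2 := (Measure.quasiMeasurePreserving_eval (fun _ : Fin J => Γ) ⟨0, hJ⟩).ae h1
    filter_upwards [h2] with t ht q
    set s := t ⟨0, hJ⟩ with hs
    have hs0 : ∫ w, oracleTerm P kX kY s w ∂P ≠ 0 := ht
    refine tendsto_measure_one_of_ae_eventually μ ?_
    have hfW : ∀ i, HasLaw (fun ω => oracleTerm P kX kY s (W i ω))
        (P.map (oracleTerm P kX kY s)) μ := fun i =>
      HasLaw.fun_comp ⟨(hm s).aemeasurable, rfl⟩ (hW_law i)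
    have hmean : ∫ ω, oracleTerm P kX kY s (W 0 ω) ∂μ = ∫ w, oracleTerm P kX kY s w ∂P :=
      (hW_law 0).integral_comp (hm s).aestronglyMeasurable
    have hlln := strong_law_ae_real (μ := μ) (fun i ω => oracleTerm P kX kY s (W i ω))
      (Integrable.of_bound (hfW 0).aemeasurable.aestronglyMeasurable C
        (Eventually.of_forall fun ω => hC _ _))
      (fun i j hij => (hW_indep.indepFun hij).comp (hm s) (hm s))
      (fun i => (hfW i).identDistrib (hfW 0))
    rw [hmean] at hlln
    filter_upwards [hlln] with ω hω
    have hω' : Tendsto (fun n => oracleDelta P kX kY (fun i => W i ω) n s) atTop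
        (𝓝 (∫ w, oracleTerm P kX kY s w ∂P)) := by
      refine hω.congr fun n => ?_
      rw [oracleDelta, one_div, div_eq_inv_mul]
    have hp0 : 0 < p := by linarith
    have hpow := (hω'.abs.rpow_const (p := p) (Or.inr hp0.le))
    have hn : Tendsto (fun n : ℕ => (n : ℝ) ^ (p / 2)) atTop atTop :=
      (tendsto_rpow_atTop (by positivity)).comp tendsto_natCast_atTop_atTop
    have htop := hn.atTop_mul_pos (Real.rpow_pos_of_pos (abs_pos.2 hs0) p) hpow
    filter_upwards [htop.eventually_ge_atTop q] with n hq
    refine hq.trans (mul_le_mul_of_nonneg_left ?_ (by positivity))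
    exact Finset.single_le_sum (f := fun j => |oracleDelta P kX kY (fun i => W i ω) n (t j)| ^ p)
      (fun j _ => by positivity) (Finset.mem_univ _)

end
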